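/- Let $\mathsf d\ge 1$ and let $\Gamma_0=\{\eta\subset\mathbb R^{\mathsf d}: |\eta|<\infty\}$ be the space of finite configurations. For $|\eta|=|\zeta|$ let $\rho(\eta,\zeta)=\min_{\varsigma}\max_{x\in\eta}|\varsigma(x)-x|$, the minimum being over all bijections $\varsigma:\eta\to\zeta$ (and $\rho(\varnothing,\varnothing)=0$). Give each $\Gamma_0^{(n)}=\{\eta:|\eta|=n\}$ the topology of the metric $\rho$ and $\Gamma_0=\bigsqcup_n\Gamma_0^{(n)}$ the disjoint union topology, and let $\mathscr B(\Gamma_0)$ be the $\sigma$-algebra generated by $\{\varnothing\}$ and the balls $\{\zeta:|\zeta|=|\eta|,\ \rho(\eta,\zeta)\le a\}$, $\eta\in\Gamma_0$, $a>0$. The Lebesgue–Poisson measure is $\lambda=\sum_{n\ge0}\frac1{n!}\lambda^{(n)}$, where $\lambda^{(0)}=\delta_{\varnothing}$ and, for $n\ge1$, $\lambda^{(n)}$ is the image of Lebesgue measure on the $n$-tuples of pairwise distinct points of $\mathbb R^{\mathsf d}$ under $(x_1,\dots,x_n)\mapsto\{x_1,\dots,x_n\}$. Let $b,d:\mathbb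 R^{\mathsf d}\times\Gamma_0\to[0,\infty)$ be (jointly) continuous functions such that 1. there are $c_1,c_2>0$ with $\int_{\mathbb R^{\mathsf d}}b(x,\eta)\,dx\le c_1|\eta|+c_2$ for all $\eta\in\Gamma_0$; 2. $\sup_{x\in\mathbb R^{\mathsf d},\,|\eta|\le m}d(x,\eta)<\infty$ for every $m\in\mathbb N$; 3. $\inf_{\eta\in\Gamma_0,\,x\in\eta}d(x,\eta)>0$; 4. there are $r>0$, $c_3>0$ and an open ball $B_\varnothing\subset\mathbb R^{\mathsf d}$ such that $b(x,\eta)>c_3$ whenever $|x-y|\le r$ for some $y\in\eta$, and $b(x,\varnothing)>c_3$ for all $x\in B_\varnothing$. Put $(B+D)(\eta)=\int_{\mathbb R^{\mathsf d}}b(x,\eta)\,dx+\sum_{x\in\eta}d(x,\eta)$, and let $(\xi_n)_{n\ge0}$ be the Markov chain on $\Gamma_0$ with transition probabilities $$Q(\eta,A)=\frac{1}{(B+D)(\eta)}\Big(\int_{\mathbb R^{\mathsf d}}\mathbf 1_A(\eta\cup\{x\})\,b(x,\eta)\,dx+\sum_{x\in\eta}\mathbf 1_A(\eta\setminus\{x\})\,d(x,\eta)\Big),$$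 and let $Q_\alpha$ be its law on $\Gamma_0^{\{0,1,2,\dots\}}$ when $\xi_0=\alpha$. Then $\lambda$ is a maximal irreducibility measure for $(\xi_n)$; that is, $\lambda$ is a non-trivial $\sigma$-finite measure and for every $A\in\mathscr B(\Gamma_0)$ $$\big(Q_\alpha\{\xi_n\in A\text{ for some }n\ge1\}>0\ \text{ for every }\alpha\in\Gamma_0\big)\iff\lambda(A)>0 .$$ -/

import Mathlib

open MeasureTheory ProbabilityTheory
open scoped ENNReal NNReal Nat

noncomputable section

/-! ## Markov chains and maximal irreducibility measures -/

/-- The law `P_μ` on the canonical space `X^ℕ` of the time-homogeneous Markov chain with transition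
kernel `P` and initial distribution `μ`. -/
def chainLaw {X : Type*} [MeasurableSpace X] (P : Kernel X X) [IsMarkovKernel P] (μ : Measure X) :
    Measure (ℕ → X) :=
  Kernel.trajMeasure (X := fun _ => X) μ fun n =>
    P.comap (fun h : (i : Finset.Iic n) → X => h ⟨n, Finset.mem_Iic.2 le_rfl⟩)
      (measurable_pi_apply _)

/-- The return probability `L(x, A) = P_x {Φ_n ∈ A for some n ≥ 1}`. -/
def returnProb {X : Type*} [MeasurableSpace X] (P : Kernel X X) [IsMarkovKernel P] (x : X)
    (A : Set X) : ℝ≥0∞ :=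
  chainLaw P (Measure.dirac x) {Φ | ∃ n, 1 ≤ n ∧ Φ n ∈ A}

/-- `ψ` is a maximal irreducibility measure for the chain with transition kernel `P`: it is a
non-trivial σ-finite measure whose sets of positive measure are exactly the measurable sets that
the chain enters with positive probability from every starting point. -/
structure IsMaximalIrreducibilityMeasure {X : Type*} [MeasurableSpace X] (P : Kernel X X)
    [IsMarkovKernel P] (ψ : Measure X) : Prop where
  sigmaFinite : SigmaFinite ψ
  nontrivial : ψ ≠ 0
  pos_iff : ∀ A : Set X, MeasurableSet A → ((∀ x, 0 < returnProb P x A) ↔ 0 < ψ A)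

/-! ## Finite configurations -/

/-- The Euclidean space `ℝ^dim`. -/
abbrev Space (dim : ℕ) : Type := EuclideanSpace ℝ (Fin dim)

/-- The space `Γ₀(ℝ^dim)` of finite subsets of `ℝ^dim`. (A structure, so as not to inherit the
measurable structure that Mathlib puts on `Finset`.) -/
@[ext]
structure FinConf (dim : ℕ) : Type where
  pts : Finset (Space dim)

namespace FinConf

variable {dim : ℕ}

/-- The number of points `|η|`. -/
def card (η : FinConf dim) : ℕ := η.pts.card

/-- The empty configuration. -/
def empty : FinConf dim := ⟨∅⟩

open Classical in
/-- `η ∪ {x}`. -/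
def insert (x : Space dim) (η : FinConf dim) : FinConf dim := ⟨Insert.insert x η.pts⟩

open Classical in
/-- `η \ {x}`. -/
def erase (η : FinConf dim) (x : Space dim) : FinConf dim := ⟨η.pts.erase x⟩

/-- `ρ(η, ζ)`, the minimum over all bijections `σ : η → ζ` of `max_{x ∈ η} |σ x - x|`.
Used only for configurations with the same number of points (it is `0` for `η = ζ = ∅`). -/
def rho (η ζ : FinConf dim) : ℝ :=
  ⨅ σ : η.pts ≃ ζ.pts, ⨆ x : η.pts, dist (σ x : Space dim) (x : Space dim)

/-- The closed ball of radius `a` around `η` inside the configurations with `|η|` points. -/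
def cball (η : FinConf dim) (a : ℝ) : Set (FinConf dim) :=
  {ζ | ζ.card = η.card ∧ rho η ζ ≤ a}

/-- The topology of `Γ₀`: the disjoint union over `n` of the spaces of `n`-point configurations,
each with the topology of the metric `ρ`. -/
instance : TopologicalSpace (FinConf dim) where
  IsOpen U := ∀ η ∈ U, ∃ a : ℝ, 0 < a ∧ cball η a ⊆ U
  isOpen_univ := fun _ _ => ⟨1, one_pos, Set.subset_univ _⟩
  isOpen_inter := by
    rintro U V hU hV η ⟨h1, h2⟩
    obtain ⟨a, ha, hsa⟩ := hU η h1
    obtain ⟨b, hb, hsb⟩ := hV η h2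
    exact ⟨min a b, lt_min ha hb, fun ζ hζ =>
      ⟨hsa ⟨hζ.1, hζ.2.trans (min_le_left _ _)⟩, hsb ⟨hζ.1, hζ.2.trans (min_le_right _ _)⟩⟩⟩
  isOpen_sUnion := by
    rintro S hS η ⟨U, hU, hη⟩
    obtain ⟨a, ha, hsa⟩ := hS U hU η hη
    exact ⟨a, ha, hsa.trans (Set.subset_sUnion_of_mem hU)⟩

/-- The σ-algebra of `Γ₀`, generated by `{∅}` and the balls of `ρ`. -/
instance : MeasurableSpace (FinConf dim) :=
  MeasurableSpace.generateFrom
    (Insert.insert {empty} {B | ∃ (η : FinConf dim) (a : ℝ), 0 < a ∧ B = cball η a})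

/-- The `n`-tuples of pairwise distinct points of `ℝ^dim`. -/
abbrev Tuple (dim n : ℕ) : Type := {t : Fin n → Space dim // Function.Injective t}

open Classical in
/-- The map `(x₁, …, x_n) ↦ {x₁, …, x_n}`, on arbitrary tuples. -/
def ofTuple {n : ℕ} (t : Fin n → Space dim) : FinConf dim := ⟨Finset.univ.image t⟩

/-- The map `sym`, that is `(x₁, …, x_n) ↦ {x₁, …, x_n}` on tuples of distinct points. -/
def sym {n : ℕ} (t : Tuple dim n) : FinConf dim := ofTuple t.1

/-- The Lebesgue–Poisson measure `λ = ∑ₙ (1/n!) λ⁽ⁿ⁾`, where `λ⁽ⁿ⁾` is the image under `sym` of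
the Lebesgue measure of `(ℝ^dim)^n` restricted to the tuples of distinct points. -/
def lebesguePoisson (dim : ℕ) : Measure (FinConf dim) :=
  Measure.sum fun n : ℕ =>
    ((n ! : ℕ) : ℝ≥0∞)⁻¹ • Measure.map ofTuple
      ((volume : Measure (Fin n → Space dim)).restrict {t | Function.Injective t})

/-! ### Measurability facts that the transition kernel needs -/

lemma mem_cball_iff {η ζ : FinConf dim} {a : ℝ} (ha : 0 ≤ a) :
    ζ ∈ cball η a ↔ ∃ σ : η.pts ≃ ζ.pts, ∀ x, dist (σ x : Space dim) (x : Space dim) ≤ a := by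
  constructor
  · rintro ⟨h1, h2⟩
    have : Nonempty (η.pts ≃ ζ.pts) := ⟨Finset.equivOfCardEq h1.symm⟩
    obtain ⟨σ, hσ⟩ := exists_eq_ciInf_of_finite
      (f := fun σ : η.pts ≃ ζ.pts => ⨆ x : η.pts, dist (σ x : Space dim) (x : Space dim))
    refine ⟨σ, fun x => ?_⟩
    have h3 : ⨆ x : η.pts, dist (σ x : Space dim) (x : Space dim) ≤ a := by
      rw [hσ]; exact h2
    exact (le_ciSup (Set.finite_range _).bddAbove x).trans h3
  · rintro ⟨σ, hσ⟩
    refine ⟨(Finset.card_eq_of_equiv σ).symm, ?_⟩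
    exact (ciInf_le (Set.finite_range _).bddBelow σ).trans (Real.iSup_le hσ ha)

lemma measurableSet_cball (η : FinConf dim) {a : ℝ} (ha : 0 < a) : MeasurableSet (cball η a) :=
  MeasurableSpace.measurableSet_generateFrom (Or.inr ⟨η, a, ha, rfl⟩)

lemma mem_ofTuple {n : ℕ} {t : Fin n → Space dim} {x : Space dim} :
    x ∈ (ofTuple t).pts ↔ ∃ i, t i = x := by
  simp [ofTuple]

lemma ofTuple_mem_cball_iff {n : ℕ} {t : Fin n → Space dim} {η : FinConf dim} {a : ℝ}
    (ha : 0 ≤ a) :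
    ofTuple t ∈ cball η a ↔ ∃ f : Fin n → η.pts, Function.Surjective f ∧
      (∀ i j, t i = t j ↔ f i = f j) ∧ ∀ i, dist (t i) (f i) ≤ a := by
  rw [mem_cball_iff ha]
  constructor
  · rintro ⟨σ, hσ⟩
    let s : Fin n → (ofTuple t).pts := fun i => ⟨t i, mem_ofTuple.2 ⟨i, rfl⟩⟩
    refine ⟨fun i => σ.symm (s i), ?_, ?_, ?_⟩
    · refine σ.symm.surjective.comp ?_
      rintro ⟨x, hx⟩
      obtain ⟨i, rfl⟩ := mem_ofTuple.1 hx
      exact ⟨i, rfl⟩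
    · intro i j
      simp [s]
    · intro i
      have := hσ (σ.symm (s i))
      simpa [s] using this
  · rintro ⟨f, hf, hij, hd⟩
    choose g hg using hf
    have hinj : Function.Bijective
        (fun x : η.pts => (⟨t (g x), mem_ofTuple.2 ⟨_, rfl⟩⟩ : (ofTuple t).pts)) := by
      constructor
      · intro x y hxy
        have : t (g x) = t (g y) := congrArg Subtype.val hxy
        rw [hij, hg, hg] at this
        exact this
      · rintro ⟨x, hx⟩
        obtain ⟨i, rfl⟩ := mem_ofTuple.1 hx
        refine ⟨f i, Subtype.ext ?_⟩
        exact (hij _ _).2 (hg _)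
    refine ⟨Equiv.ofBijective _ hinj, fun x => ?_⟩
    have := hd (g x)
    rw [hg] at this
    exact this

lemma ofTuple_eq_empty_iff {n : ℕ} {t : Fin n → Space dim} : ofTuple t = empty ↔ n = 0 := by
  simp only [ofTuple, empty, FinConf.mk.injEq, Finset.image_eq_empty]
  constructor
  · intro h
    by_contra hn
    exact (Finset.notMem_empty (⟨0, Nat.pos_of_ne_zero hn⟩ : Fin n)) (h ▸ Finset.mem_univ _)
  · rintro rfl
    rfl

lemma measurable_ofTuple {n : ℕ} :
    Measurable (ofTuple : (Fin n → Space dim) → FinConf dim) := by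
  refine measurable_generateFrom ?_
  rintro B (rfl | ⟨η, a, ha, rfl⟩)
  · have : (ofTuple : (Fin n → Space dim) → FinConf dim) ⁻¹' {empty} = {_t | n = 0} := by
      ext t
      simp [ofTuple_eq_empty_iff]
    rw [this]
    exact MeasurableSet.const _
  · have : (ofTuple : (Fin n → Space dim) → FinConf dim) ⁻¹' (cball η a) =
        ⋃ f : Fin n → η.pts, {t : Fin n → Space dim | Function.Surjective f ∧
          (∀ i j, t i = t j ↔ f i = f j) ∧ ∀ i, dist (t i) (f i : Space dim) ≤ a} := by
      ext t
      simp only [Set.mem_preimage, ofTuple_mem_cball_iff ha.le, Set.mem_iUnion, Set.mem_ofPred_eq]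
    rw [this]
    refine MeasurableSet.iUnion fun f => ?_
    refine (MeasurableSet.const _).inter (MeasurableSet.inter ?_ ?_)
    · change MeasurableSet {t : Fin n → Space dim | ∀ i j, t i = t j ↔ f i = f j}
      rw [Set.ofPred_forall]
      refine MeasurableSet.iInter fun i => ?_
      rw [Set.ofPred_forall]
      refine MeasurableSet.iInter fun j => ?_
      have h1 : MeasurableSet {t : Fin n → Space dim | t i = t j} :=
        measurableSet_eq_fun (measurable_pi_apply i) (measurable_pi_apply j)
      by_cases h : f i = f j
      · simpa [h] using h1
      · simp only [h, iff_false]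
        exact h1.compl
    · change MeasurableSet {t : Fin n → Space dim | ∀ i, dist (t i) (f i : Space dim) ≤ a}
      rw [Set.ofPred_forall]
      refine MeasurableSet.iInter fun i => ?_
      exact measurableSet_le ((measurable_pi_apply i).dist measurable_const) measurable_const

lemma measurable_sym {n : ℕ} : Measurable (sym : Tuple dim n → FinConf dim) :=
  measurable_ofTuple.comp measurable_subtype_coe

lemma sym_mem_cball {n : ℕ} (s t : Tuple dim n) {a : ℝ} (h : dist s t ≤ a) :
    sym t ∈ cball (sym s) a := by
  have ha : 0 ≤ a := dist_nonneg.trans h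
  refine (ofTuple_mem_cball_iff ha).2 ⟨fun i => ⟨s.1 i, mem_ofTuple.2 ⟨i, rfl⟩⟩, ?_, ?_, ?_⟩
  · rintro ⟨x, hx⟩
    obtain ⟨i, rfl⟩ := mem_ofTuple.1 hx
    exact ⟨i, rfl⟩
  · intro i j
    exact t.2.eq_iff.trans (s.2.eq_iff.symm.trans Subtype.mk_eq_mk.symm)
  · intro i
    have h1 : dist (t.1 i) (s.1 i) ≤ dist t.1 s.1 := dist_le_pi_dist _ _ i
    have h2 : dist t.1 s.1 = dist s t := by rw [dist_comm]; rfl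
    exact h1.trans (h2.le.trans h)

lemma continuous_sym {n : ℕ} : Continuous (sym : Tuple dim n → FinConf dim) := by
  refine continuous_def.2 fun U hU => Metric.isOpen_iff.2 fun s hs => ?_
  obtain ⟨a, ha, hsub⟩ := hU (sym s) hs
  exact ⟨a, ha, fun t ht => hsub (sym_mem_cball s t (by
    rw [dist_comm]; exact (Metric.mem_ball.1 ht).le))⟩

lemma exists_sym_eq (η : FinConf dim) : ∃ (n : ℕ) (t : Tuple dim n), sym t = η := by
  refine ⟨η.pts.card, ⟨fun i => (η.pts.equivFin.symm i : Space dim), fun i j h =>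
    η.pts.equivFin.symm.injective (Subtype.ext h)⟩, ?_⟩
  ext x
  simp only [sym, mem_ofTuple]
  constructor
  · rintro ⟨i, rfl⟩
    exact (η.pts.equivFin.symm i).2
  · intro hx
    exact ⟨η.pts.equivFin ⟨x, hx⟩, by simp⟩

lemma eq_of_forall_mem_cball {η ζ : FinConf dim}
    (h : ∀ a : ℝ, 0 < a → ∃ c : FinConf dim, η ∈ cball c a ∧ ζ ∈ cball c a) : η = ζ := by
  have hcard : η.card = ζ.card := by
    obtain ⟨c, h1, h2⟩ := h 1 one_pos
    exact h1.1.trans h2.1.symm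
  ext1
  refine Finset.eq_of_subset_of_card_le (fun x hx => ?_) hcard.ge
  have hcl : x ∈ closure (ζ.pts : Set (Space dim)) := by
    refine Metric.mem_closure_iff.2 fun ε hε => ?_
    obtain ⟨c, h1, h2⟩ := h (ε / 3) (by positivity)
    obtain ⟨σ, hσ⟩ := (mem_cball_iff (by positivity)).1 h1
    obtain ⟨τ, hτ⟩ := (mem_cball_iff (by positivity)).1 h2
    have e1 := hσ (σ.symm ⟨x, hx⟩)
    have e2 := hτ (σ.symm ⟨x, hx⟩)
    rw [Equiv.apply_symm_apply] at e1
    refine ⟨τ (σ.symm ⟨x, hx⟩), (τ (σ.symm ⟨x, hx⟩)).2, ?_⟩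
    have e3 := dist_triangle_right x (τ (σ.symm ⟨x, hx⟩) : Space dim)
      (σ.symm ⟨x, hx⟩ : Space dim)
    have e4 : dist x (σ.symm ⟨x, hx⟩ : Space dim) ≤ ε / 3 := e1
    linarith
  rw [ζ.pts.finite_toSet.isClosed.closure_eq] at hcl
  exact hcl

instance : MeasurableSpace.CountablySeparated (Space dim × FinConf dim) := by
  have hE : MeasurableSpace.CountablySeparated (Space dim) := inferInstance
  obtain ⟨S, hSc, hSm, hS⟩ := hE.countably_separated.exists_countable_separating
  let C : Set (Set (FinConf dim)) :=
    ⋃ n : ℕ, ⋃ s ∈ TopologicalSpace.exists_countable_dense (Tuple dim n) |>.choose,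
      Set.range fun k : ℕ => cball (sym s) (1 / ((k : ℝ) + 1))
  have hCc : C.Countable := by
    refine Set.countable_iUnion fun n => Set.Countable.biUnion
      (TopologicalSpace.exists_countable_dense (Tuple dim n)).choose_spec.1 fun s _ =>
        Set.countable_range _
  refine ⟨⟨(fun s => Prod.fst ⁻¹' s) '' S ∪ (fun s => Prod.snd ⁻¹' s) '' C,
    (hSc.image _).union (hCc.image _), ?_, ?_⟩⟩
  · rintro _ (⟨s, hs, rfl⟩ | ⟨s, hs, rfl⟩)
    · exact measurable_fst (hSm s hs)
    · simp only [C, Set.mem_iUnion] at hs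
      obtain ⟨n, t, -, k, rfl⟩ := hs
      exact measurable_snd (measurableSet_cball _ (by positivity))
  · rintro ⟨x, η⟩ - ⟨y, ζ⟩ - h
    have hxy : x = y := hS x trivial y trivial fun s hs =>
      h _ (Or.inl ⟨s, hs, rfl⟩)
    have hηζ : η = ζ := by
      refine eq_of_forall_mem_cball fun a ha => ?_
      obtain ⟨k, hk⟩ := exists_nat_one_div_lt ha
      obtain ⟨n, t, rfl⟩ := exists_sym_eq η
      have hd := (TopologicalSpace.exists_countable_dense (Tuple dim n)).choose_spec.2
      obtain ⟨s, hs, hst⟩ := Metric.mem_closure_iff.1 (hd t) (1 / ((k : ℝ) + 1)) (by positivity)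
      have hmem : cball (sym s) (1 / ((k : ℝ) + 1)) ∈ C :=
        Set.mem_iUnion.2 ⟨n, Set.mem_iUnion₂.2 ⟨s, hs, ⟨k, rfl⟩⟩⟩
      have h1 : sym t ∈ cball (sym s) (1 / ((k : ℝ) + 1)) :=
        sym_mem_cball s t (by rw [dist_comm]; exact hst.le)
      have h2 : ζ ∈ cball (sym s) (1 / ((k : ℝ) + 1)) :=
        (h _ (Or.inr ⟨_, hmem, rfl⟩)).1 h1
      exact ⟨sym s, ⟨h1.1, h1.2.trans hk.le⟩, ⟨h2.1, h2.2.trans hk.le⟩⟩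
    rw [hxy, hηζ]

lemma isOpen_injective {n : ℕ} :
    IsOpen {t : Fin n → Space dim | Function.Injective t} := by
  have : {t : Fin n → Space dim | Function.Injective t} =
      ⋂ i, ⋂ j, {t : Fin n → Space dim | i = j ∨ t i ≠ t j} := by
    ext t
    simp only [Set.mem_iInter, Set.mem_ofPred_eq, Function.Injective]
    exact forall₂_congr fun i j => by tauto
  rw [this]
  refine isOpen_iInter_of_finite fun i => isOpen_iInter_of_finite fun j => ?_
  by_cases h : i = j
  · simp [h]
  · simp only [h, false_or]
    exact isOpen_ne_fun (continuous_apply i) (continuous_apply j)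

instance {n : ℕ} : PolishSpace (Tuple dim n) := isOpen_injective.polishSpace

/-- Measurability of a function of a point and a configuration can be tested on tuples. -/
lemma measurable_of_sym {Y : Type*} [MeasurableSpace Y] {f : Space dim × FinConf dim → Y}
    (hf : ∀ n, Measurable fun p : Space dim × Tuple dim n => f (p.1, sym p.2)) :
    Measurable f := by
  let _ : MeasurableSpace (Σ n, Space dim × Tuple dim n) := borel _
  have : BorelSpace (Σ n, Space dim × Tuple dim n) := ⟨rfl⟩
  have key : ∀ s : Set (Σ n, Space dim × Tuple dim n),
      (∀ n, MeasurableSet (Sigma.mk n ⁻¹' s)) → MeasurableSet s := by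
    intro s hs
    have : s = ⋃ n, Sigma.mk n '' (Sigma.mk n ⁻¹' s) := by
      ext ⟨n, p⟩
      simp only [Set.mem_preimage, Set.mem_iUnion, Set.mem_image]
      constructor
      · intro h
        exact ⟨n, p, h, rfl⟩
      · rintro ⟨m, q, hq, h⟩
        rw [← h]
        exact hq
    rw [this]
    exact MeasurableSet.iUnion fun n =>
      Topology.IsOpenEmbedding.sigmaMk.measurableEmbedding.measurableSet_image.2 (hs n)
  let F : (Σ n, Space dim × Tuple dim n) → Space dim × FinConf dim := fun q => (q.2.1, sym q.2.2)
  have hF : Measurable F := fun s hs => key _ fun n =>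
    (measurable_fst.prodMk (measurable_sym.comp measurable_snd)) hs
  have hsurj : Function.Surjective F := by
    rintro ⟨x, η⟩
    obtain ⟨n, t, rfl⟩ := exists_sym_eq η
    exact ⟨⟨n, x, t⟩, rfl⟩
  exact (hF.measurable_comp_iff_of_surjective hsurj).1 fun s hs => key _ fun n => hf n hs

lemma measurable_of_sym' {Y : Type*} [MeasurableSpace Y] {f : FinConf dim → Y}
    (hf : ∀ n, Measurable fun t : Tuple dim n => f (sym t)) : Measurable f := by
  have h : Measurable fun p : Space dim × FinConf dim => f p.2 :=
    measurable_of_sym fun n => (hf n).comp measurable_snd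
  exact h.comp (measurable_prodMk_left (x := (0 : Space dim)))

lemma measurable_of_continuous {Y : Type*} [MeasurableSpace Y] [TopologicalSpace Y]
    [BorelSpace Y] {f : Space dim × FinConf dim → Y} (hf : Continuous f) : Measurable f :=
  measurable_of_sym fun _ =>
    (hf.comp (continuous_fst.prodMk (continuous_sym.comp continuous_snd))).measurable

lemma measurable_insert :
    Measurable fun p : Space dim × FinConf dim => insert p.1 p.2 := by
  refine measurable_of_sym fun n => ?_
  have : (fun p : Space dim × Tuple dim n => insert p.1 (sym p.2)) =
      fun p => ofTuple (Fin.cons p.1 p.2.1 : Fin (n + 1) → Space dim) := by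
    funext p
    ext x
    simp only [insert, Finset.mem_insert, sym, mem_ofTuple, Fin.exists_fin_succ, Fin.cons_zero,
      Fin.cons_succ, eq_comm]
  rw [this]
  refine measurable_ofTuple.comp (measurable_pi_iff.2 fun i => ?_)
  refine Fin.cases ?_ (fun j => ?_) i
  · simpa using measurable_fst
  · simp only [Fin.cons_succ]
    exact (measurable_pi_apply j).comp (measurable_subtype_coe.comp measurable_snd)

lemma measurable_sum_erase {g : Space dim × FinConf dim → ℝ≥0∞} (hg : Measurable g)
    {A : Set (FinConf dim)} (hA : MeasurableSet A) :
    Measurable fun η : FinConf dim =>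
      ∑ x ∈ η.pts, g (x, η) * A.indicator 1 (η.erase x) := by
  refine measurable_of_sym' fun n => ?_
  have h1 : (fun t : Tuple dim n => ∑ x ∈ (sym t).pts,
      g (x, sym t) * A.indicator 1 ((sym t).erase x)) =
      fun t => ∑ i : Fin n, g (t.1 i, sym t) * A.indicator 1 ((sym t).erase (t.1 i)) := by
    funext t
    simp only [sym, ofTuple]
    exact Finset.sum_image fun i _ j _ h => t.2 h
  rw [h1]
  refine Finset.measurable_sum _ fun i _ => Measurable.mul ?_ ?_
  · exact hg.comp (((measurable_pi_apply i).comp measurable_subtype_coe).prodMk measurable_sym)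
  · refine (measurable_one.indicator hA).comp ?_
    obtain _ | m := n
    · exact i.elim0
    have : (fun t : Tuple dim (m + 1) => (sym t).erase (t.1 i)) =
        fun t => ofTuple fun j => t.1 (i.succAbove j) := by
      funext t
      ext x
      simp only [erase, Finset.mem_erase, sym, mem_ofTuple]
      constructor
      · rintro ⟨hne, j, rfl⟩
        have hji : j ≠ i := fun h => hne (by rw [h])
        obtain ⟨k, rfl⟩ := Fin.exists_succAbove_eq hji
        exact ⟨k, rfl⟩
      · rintro ⟨k, rfl⟩
        exact ⟨fun h => Fin.succAbove_ne i k (t.2 h), _, rfl⟩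
    rw [this]
    exact measurable_ofTuple.comp (measurable_pi_iff.2 fun j =>
      (measurable_pi_apply _).comp measurable_subtype_coe)

end FinConf

/-! ## The embedded chain of a spatial birth-and-death process -/

/-- The assumptions on the birth rate `b` and the death rate `d`. -/
structure AdmissibleRates {dim : ℕ} (b d : Space dim → FinConf dim → ℝ≥0) : Prop where
  continuous_birth : Continuous fun p : Space dim × FinConf dim => b p.1 p.2
  continuous_death : Continuous fun p : Space dim × FinConf dim => d p.1 p.2
  /-- Sublinear growth of the total birth rate. -/
  sublinear : ∃ c₁ c₂ : ℝ≥0, 0 < c₁ ∧ 0 < c₂ ∧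
    ∀ η : FinConf dim, (∫⁻ x, (b x η : ℝ≥0∞)) ≤ c₁ * (η.card : ℝ≥0∞) + c₂
  /-- The death rate is bounded on configurations with at most `m` points. -/
  death_bounded : ∀ m : ℕ, ∃ M : ℝ≥0, ∀ (x : Space dim) (η : FinConf dim), η.card ≤ m → d x η ≤ M
  /-- The death rate of the points of a configuration is bounded away from zero. -/
  death_pos : ∃ δ : ℝ≥0, 0 < δ ∧ ∀ η : FinConf dim, ∀ x ∈ η.pts, δ ≤ d x η
  /-- Non-degeneracy of the birth rate. -/
  birth_pos : ∃ (r : ℝ) (c₃ : ℝ≥0), 0 < r ∧ 0 < c₃ ∧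
    (∀ (x : Space dim) (η : FinConf dim), (∃ y ∈ η.pts, dist x y ≤ r) → c₃ < b x η) ∧
    ∃ (x₀ : Space dim) (R : ℝ), 0 < R ∧ ∀ x ∈ Metric.ball x₀ R, c₃ < b x FinConf.empty

/-- The jump rate `(B + D)(η) = ∫ b(x, η) dx + ∑_{x ∈ η} d(x, η)`. -/
def totalRate {dim : ℕ} (b d : Space dim → FinConf dim → ℝ≥0) (η : FinConf dim) : ℝ≥0∞ :=
  (∫⁻ x, (b x η : ℝ≥0∞)) + ∑ x ∈ η.pts, (d x η : ℝ≥0∞)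

/-- The transition probability `Q(η, ·)` of the embedded chain: from `η` the chain moves to
`η ∪ {x}` with density `b(x, η) / (B + D)(η)` in `x`, and to `η \ {x}`, `x ∈ η`, with
probability `d(x, η) / (B + D)(η)`. -/
def jumpMeasure {dim : ℕ} (b d : Space dim → FinConf dim → ℝ≥0) (η : FinConf dim) :
    Measure (FinConf dim) :=
  (totalRate b d η)⁻¹ •
    (Measure.map (fun x => FinConf.insert x η) (volume.withDensity fun x => (b x η : ℝ≥0∞)) +
      ∑ x ∈ η.pts, (d x η : ℝ≥0∞) • Measure.dirac (η.erase x))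

namespace AdmissibleRates

variable {dim : ℕ} {b d : Space dim → FinConf dim → ℝ≥0}

lemma measurable_birth (h : AdmissibleRates b d) :
    Measurable fun p : Space dim × FinConf dim => (b p.1 p.2 : ℝ≥0∞) :=
  (FinConf.measurable_of_continuous h.continuous_birth).coe_nnreal_ennreal

lemma measurable_death (h : AdmissibleRates b d) :
    Measurable fun p : Space dim × FinConf dim => (d p.1 p.2 : ℝ≥0∞) :=
  (FinConf.measurable_of_continuous h.continuous_death).coe_nnreal_ennreal

lemma jumpMeasure_apply (η : FinConf dim) {A : Set (FinConf dim)}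
    (hA : MeasurableSet A) :
    jumpMeasure b d η A = (totalRate b d η)⁻¹ *
      ((∫⁻ x, (b x η : ℝ≥0∞) * A.indicator 1 (FinConf.insert x η)) +
        ∑ x ∈ η.pts, (d x η : ℝ≥0∞) * A.indicator 1 (η.erase x)) := by
  have hins : Measurable fun x : Space dim => FinConf.insert x η :=
    FinConf.measurable_insert.comp measurable_prodMk_right
  rw [jumpMeasure, Measure.smul_apply, Measure.add_apply, Measure.map_apply hins hA,
    withDensity_apply _ (hins hA), ← lintegral_indicator (hins hA), Measure.finsetSum_apply,
    smul_eq_mul]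
  congr 2
  · refine lintegral_congr fun x => ?_
    by_cases hx : FinConf.insert x η ∈ A <;> simp [Set.indicator, hx]
  · refine Finset.sum_congr rfl fun x _ => ?_
    rw [Measure.smul_apply, Measure.dirac_apply' _ hA, smul_eq_mul]

lemma measurable_jumpMeasure (h : AdmissibleRates b d) : Measurable (jumpMeasure b d) := by
  refine Measure.measurable_of_measurable_coe _ fun A hA => ?_
  simp only [jumpMeasure_apply _ hA]
  have hb : ∀ {B : Set (FinConf dim)}, MeasurableSet B → Measurable fun η : FinConf dim =>
      ∫⁻ x, (b x η : ℝ≥0∞) * B.indicator 1 (FinConf.insert x η) := fun hB =>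
    Measurable.lintegral_prod_left' (f := fun p : Space dim × FinConf dim =>
        (b p.1 p.2 : ℝ≥0∞) * Set.indicator _ 1 (FinConf.insert p.1 p.2))
      (h.measurable_birth.mul ((measurable_one.indicator hB).comp FinConf.measurable_insert))
  have htot : Measurable (totalRate b d) := by
    have h1 := hb MeasurableSet.univ
    have h2 := FinConf.measurable_sum_erase h.measurable_death MeasurableSet.univ
    have h3 := h1.add h2
    simp only [Set.indicator_univ, Pi.one_apply, mul_one] at h3
    exact h3
  exact htot.inv.mul ((hb hA).add (FinConf.measurable_sum_erase h.measurable_death hA))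

lemma totalRate_ne_top (h : AdmissibleRates b d) (η : FinConf dim) : totalRate b d η ≠ ∞ := by
  obtain ⟨c₁, c₂, -, -, hc⟩ := h.sublinear
  refine ENNReal.add_ne_top.2 ⟨ne_top_of_le_ne_top ?_ (hc η), ?_⟩
  · exact ENNReal.add_ne_top.2
      ⟨ENNReal.mul_ne_top ENNReal.coe_ne_top (ENNReal.natCast_ne_top _), ENNReal.coe_ne_top⟩
  · exact ENNReal.sum_ne_top.2 fun _ _ => ENNReal.coe_ne_top

lemma totalRate_ne_zero (h : AdmissibleRates b d) (η : FinConf dim) : totalRate b d η ≠ 0 := by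
  intro h0
  obtain ⟨hB, hD⟩ := add_eq_zero.1 h0
  have hne : η.pts = ∅ := by
    refine Finset.eq_empty_of_forall_notMem fun x hx => ?_
    obtain ⟨δ, hδ, hd⟩ := h.death_pos
    have h1 := (Finset.sum_eq_zero_iff.1 hD) x hx
    have h2 := hd η x hx
    rw [ENNReal.coe_eq_zero.1 h1] at h2
    exact absurd hδ (not_lt.2 h2)
  obtain rfl : η = FinConf.empty := FinConf.ext hne
  obtain ⟨r, c₃, -, hc, -, x₀, R, hR, hball⟩ := h.birth_pos
  have h1 : ∫⁻ _ in Metric.ball x₀ R, (c₃ : ℝ≥0∞) ≤ ∫⁻ x, (b x FinConf.empty : ℝ≥0∞) :=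
    (setLIntegral_mono' measurableSet_ball fun x hx => ENNReal.coe_le_coe.2 (hball x hx).le).trans
      (setLIntegral_le_lintegral _ _)
  rw [hB, setLIntegral_const, nonpos_iff_eq_zero, mul_eq_zero] at h1
  rcases h1 with h1 | h1
  · exact hc.ne' (ENNReal.coe_eq_zero.1 h1)
  · exact (Metric.measure_ball_pos volume x₀ hR).ne' h1

/-- The transition kernel `Q` of the embedded Markov chain. -/
def jumpKernel (h : AdmissibleRates b d) : Kernel (FinConf dim) (FinConf dim) where
  toFun := jumpMeasure b d
  measurable' := h.measurable_jumpMeasure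

instance (h : AdmissibleRates b d) : IsMarkovKernel h.jumpKernel := by
  refine ⟨fun η => ⟨?_⟩⟩
  change jumpMeasure b d η Set.univ = 1
  rw [jumpMeasure_apply η MeasurableSet.univ]
  simpa [totalRate] using ENNReal.inv_mul_cancel (h.totalRate_ne_zero η) (h.totalRate_ne_top η)

end AdmissibleRates

end

/-!
From `λ`-almost every configuration a single birth or death leads almost surely outside a given
`λ`-null set, and `{∅}` is an atom of `λ`. Hence the chain started at `∅` has at each time a law
absolutely continuous with respect to `λ`, and only sets of positive measure are reached from `∅`.

Conversely, the configurations from which a set is never reached form an absorbing set, and a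
nonempty absorbing set has full measure. Indeed, killing points leads to `∅`, and a birth leads
from `∅` to a one-point configuration. From `η ∪ {z}`, a birth at distance less than `r` from `z`
and then the death of `z` lead to almost every `η ∪ {x}` with `|x - z| < r`. Iterating this,
almost every point of `ℝ^dim` can be added to `η`, and so almost every configuration is built up
point by point.
-/

section MarkovChain

variable {X : Type*} [MeasurableSpace X] {P : Kernel X X} {ψ : Measure X} {A : Set X}

lemma map_eval_zero_chainLaw (P : Kernel X X) [IsMarkovKernel P] (μ : Measure X)
    [IsProbabilityMeasure μ] : (chainLaw P μ).map (fun Φ => Φ 0) = μ := by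
  rw [chainLaw, Kernel.trajMeasure,
    show (fun Φ : ℕ → X => Φ 0) =
      (fun h : (i : Finset.Iic 0) → X => h ⟨0, Finset.mem_Iic.2 le_rfl⟩) ∘
        Preorder.frestrictLe 0 from rfl,
    ← Measure.map_map (by fun_prop) (by fun_prop), Measure.map_comp _ _ (by fun_prop),
    Kernel.traj_map_frestrictLe, Kernel.partialTraj_self, Measure.id_comp,
    Measure.map_map (by fun_prop) (by fun_prop)]
  exact Measure.map_id

lemma map_eval_succ_chainLaw (P : Kernel X X) [IsMarkovKernel P] (μ : Measure X)
    [IsProbabilityMeasure μ] (n : ℕ) :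
    (chainLaw P μ).map (fun Φ => Φ (n + 1)) = P ∘ₘ (chainLaw P μ).map (fun Φ => Φ n) := by
  have hlast : Measurable fun h : (i : Finset.Iic n) → X => h ⟨n, Finset.mem_Iic.2 le_rfl⟩ :=
    measurable_pi_apply _
  have hprob : IsProbabilityMeasure (chainLaw P μ) := by unfold chainLaw; infer_instance
  have hjoint := Kernel.map_frestrictLe_trajMeasure_compProd_eq_map_trajMeasure
    (X := fun _ => X) (μ₀ := μ) (a := n)
    (κ := fun n => P.comap (fun h : (i : Finset.Iic n) → X => h ⟨n, Finset.mem_Iic.2 le_rfl⟩)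
      (measurable_pi_apply _))
  calc (chainLaw P μ).map (fun Φ => Φ (n + 1))
    _ = ((chainLaw P μ).map fun Φ => (Preorder.frestrictLe n Φ, Φ (n + 1))).snd := by
      rw [Measure.snd_map_prodMk (by fun_prop)]
    _ = P.comap _ hlast ∘ₘ (chainLaw P μ).map (Preorder.frestrictLe n) := by
      rw [← Measure.snd_compProd]
      exact congrArg Measure.snd hjoint.symm
    _ = P ∘ₘ (chainLaw P μ).map (fun Φ => Φ n) := by
      rw [← Kernel.comp_deterministic_eq_comap, ← Measure.comp_assoc,
        Measure.deterministic_comp_eq_map, Measure.map_map hlast (by fun_prop)]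
      rfl

lemma map_eval_chainLaw (P : Kernel X X) [IsMarkovKernel P] (μ : Measure X)
    [IsProbabilityMeasure μ] (n : ℕ) : (chainLaw P μ).map (fun Φ => Φ n) = (P ^ n) ∘ₘ μ := by
  induction n with
  | zero => rw [map_eval_zero_chainLaw]; exact Measure.id_comp.symm
  | succ n ih => rw [map_eval_succ_chainLaw, ih, Measure.comp_assoc, pow_succ']; rfl

lemma returnProb_pos_iff [IsMarkovKernel P] {x : X} (hA : MeasurableSet A) :
    0 < returnProb P x A ↔ ∃ n, 0 < (P ^ (n + 1)) x A := by
  have hunion : {Φ : ℕ → X | ∃ n, 1 ≤ n ∧ Φ n ∈ A} = ⋃ n, (fun Φ => Φ (n + 1)) ⁻¹' A := by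
    ext Φ
    simp only [Set.mem_iUnion, Set.mem_preimage, Set.mem_ofPred_eq]
    refine ⟨?_, fun ⟨n, hn⟩ => ⟨n + 1, Nat.le_add_left 1 n, hn⟩⟩
    rintro ⟨_ | n, hn, h⟩
    · exact absurd hn (by decide)
    · exact ⟨n, h⟩
  simp only [pos_iff_ne_zero]
  rw [returnProb, hunion, Ne, measure_iUnion_null_iff, not_forall]
  refine exists_congr fun n => ?_
  rw [← Measure.map_apply (measurable_pi_apply _) hA, map_eval_chainLaw,
    Measure.dirac_bind (P ^ (n + 1)).measurable]

lemma pow_comp_absolutelyContinuous (hP : P ∘ₘ ψ ≪ ψ) (n : ℕ) : (P ^ n) ∘ₘ ψ ≪ ψ := by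
  induction n with
  | zero => exact Measure.id_comp.absolutelyContinuous
  | succ n ih =>
    rw [add_comm, Kernel.pow_add, pow_one, ← Measure.comp_assoc]
    exact (ih.comp_right P).trans hP

/-- Absorbing sets in the sense of Meyn and Tweedie: the chain almost surely never leaves `C`.
The empty set is allowed. -/
structure IsAbsorbing (P : Kernel X X) (C : Set X) : Prop where
  measurableSet : MeasurableSet C
  ae_mem : ∀ x ∈ C, ∀ᵐ y ∂P x, y ∈ C

lemma pow_succ_apply_eq_zero_iff (n : ℕ) (x : X) (hA : MeasurableSet A) :
    (P ^ (n + 1)) x A = 0 ↔ ∀ᵐ y ∂P x, (P ^ n) y A = 0 := by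
  rw [add_comm, Kernel.pow_add_apply_eq_lintegral _ _ _ _ hA, pow_one,
    lintegral_eq_zero_iff ((P ^ n).measurable_coe hA)]
  rfl

lemma isAbsorbing_setOf_forall_pow_apply_eq_zero (P : Kernel X X) (hA : MeasurableSet A) :
    IsAbsorbing P {x | ∀ n, (P ^ n) x A = 0} where
  measurableSet := by
    rw [Set.ofPred_forall]
    exact .iInter fun n => (P ^ n).measurable_coe hA (measurableSet_singleton 0)
  ae_mem x hx := ae_all_iff.2 fun n => (pow_succ_apply_eq_zero_iff n x hA).1 (hx (n + 1))

lemma isIrreducible_of_isAbsorbing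
    (hfull : ∀ C, IsAbsorbing P C → C.Nonempty → ∀ᵐ x ∂ψ, x ∈ C) : Kernel.IsIrreducible ψ P where
  irreducible A hA hpos x := by
    by_contra! hx
    have hC := hfull _ (isAbsorbing_setOf_forall_pow_apply_eq_zero P hA)
      ⟨x, fun n => nonpos_iff_eq_zero.1 (hx n)⟩
    refine hpos.ne' (measure_eq_zero_iff_ae_notMem.2 (hC.mono fun y hy hyA => ?_))
    have h0 : Measure.dirac y A = 0 := hy 0
    simp [hyA] at h0

lemma exists_pow_succ_apply_pos [IsMarkovKernel P] [Kernel.IsIrreducible ψ P]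
    (hA : MeasurableSet A) (hpos : 0 < ψ A) (x : X) : ∃ n, 0 < (P ^ (n + 1)) x A := by
  by_contra! hx
  have hnever : ∀ᵐ y ∂P x, ∀ n, (P ^ n) y A = 0 := ae_all_iff.2 fun n =>
    (pow_succ_apply_eq_zero_iff n x hA).1 (nonpos_iff_eq_zero.1 (hx n))
  obtain ⟨y, hy⟩ := hnever.exists
  obtain ⟨n, hn⟩ := Kernel.IsIrreducible.irreducible (κ := P) hA hpos y
  exact hn.ne' (hy n)

lemma isMaximalIrreducibilityMeasure_of_isIrreducible [IsMarkovKernel P] [SigmaFinite ψ]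
    [Kernel.IsIrreducible ψ P] (hP : P ∘ₘ ψ ≪ ψ) {x₀ : X} (hx₀ : Measure.dirac x₀ ≪ ψ) :
    IsMaximalIrreducibilityMeasure P ψ where
  sigmaFinite := inferInstance
  nontrivial := by
    rintro rfl
    exact Measure.dirac_ne_zero (Measure.absolutelyContinuous_zero_iff.1 hx₀)
  pos_iff A hA := by
    refine ⟨fun hret => ?_, fun hpos x =>
      (returnProb_pos_iff hA).2 (exists_pow_succ_apply_pos hA hpos x)⟩
    obtain ⟨n, hn⟩ := (returnProb_pos_iff hA).1 (hret x₀)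
    have hac : (P ^ (n + 1)) x₀ ≪ ψ := by
      rw [← Measure.dirac_bind (P ^ (n + 1)).measurable x₀]
      exact (hx₀.comp_right _).trans (pow_comp_absolutelyContinuous hP _)
    exact pos_iff_ne_zero.2 fun h0 => hn.ne' (hac h0)

end MarkovChain

section Spread

open Metric

lemma ae_mem_of_forall_mem_ae_ball {E : Type*} [PseudoMetricSpace E] [SecondCountableTopology E]
    [PreconnectedSpace E] [MeasurableSpace E] {μ : Measure E} [μ.IsOpenPosMeasure] {r : ℝ}
    (hr : 0 < r) {H : Set E} (hne : H.Nonempty)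
    (hH : ∀ y ∈ H, ∀ᵐ x ∂μ, x ∈ ball y r → x ∈ H) : ∀ᵐ x ∂μ, x ∈ H := by
  -- Density of `H` in the balls around points of `V` makes the closed set `V` open.
  let V : Set E := {y | ∀ᵐ x ∂μ, x ∈ ball y r → x ∈ H}
  have hclosed : IsClosed V := by
    refine IsSeqClosed.isClosed fun u y hu hlim => ?_
    filter_upwards [ae_all_iff.2 hu] with x hx hxy
    obtain ⟨n, hn⟩ := (((continuous_const.dist continuous_id).tendsto y).comp hlim
      |>.eventually_lt_const hxy).exists
    exact hx n hn
  have hball : ∀ y ∈ V, ball y r ⊆ V := fun y hy =>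
    calc ball y r
      _ ⊆ closure (ball y r ∩ {x | x ∈ ball y r → x ∈ H}) :=
        (Measure.dense_of_ae hy).open_subset_closure_inter isOpen_ball
      _ ⊆ V := closure_minimal (fun x hx => hH x (hx.2 hx.1)) hclosed
  have hopen : IsOpen V := isOpen_iff.2 fun y hy => ⟨r, hr, hball y hy⟩
  have huniv : V = Set.univ := IsClopen.eq_univ ⟨hclosed, hopen⟩ (hne.mono hH)
  refine measure_null_of_locally_null _ fun y _ =>
    ⟨_, inter_mem_nhdsWithin _ (ball_mem_nhds y hr), ?_⟩
  refine measure_mono_null (fun x hx => ?_) (huniv ▸ Set.mem_univ y : y ∈ V)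
  exact fun h => hx.1 (h hx.2)

end Spread

section Pi

variable {n : ℕ} {α : Fin (n + 1) → Type*} [∀ i, MeasurableSpace (α i)]

lemma measurePreserving_finCons (μ : ∀ i, Measure (α i)) [∀ i, SigmaFinite (μ i)] :
    MeasurePreserving (fun q : α 0 × (∀ j : Fin n, α j.succ) => (Fin.cons q.1 q.2 : ∀ i, α i))
      ((μ 0).prod (Measure.pi fun j : Fin n => μ j.succ)) (Measure.pi μ) := by
  have h := (measurePreserving_piFinSuccAbove μ 0).symm
  simp only [MeasurableEquiv.piFinSuccAbove, Fin.insertNthEquiv_zero] at h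
  exact h

lemma ae_pi_iff_ae_ae_cons {μ : ∀ i, Measure (α i)} [∀ i, SigmaFinite (μ i)]
    {p : (∀ i, α i) → Prop} (hp : MeasurableSet {t | p t}) :
    (∀ᵐ t ∂Measure.pi μ, p t) ↔
      ∀ᵐ t ∂Measure.pi (fun j => μ (Fin.succ j)), ∀ᵐ x ∂μ 0, p (Fin.cons x t) := by
  have hcons := measurePreserving_finCons μ
  rw [← hcons.map_eq, ae_map_iff hcons.measurable.aemeasurable hp]
  exact (Measure.ae_prod_iff_ae_ae (hcons.measurable hp)).trans
    (Measure.ae_ae_comm (hcons.measurable hp))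

lemma quasiMeasurePreserving_removeNth (μ : ∀ i, Measure (α i)) [∀ i, SigmaFinite (μ i)]
    (i : Fin (n + 1)) :
    Measure.QuasiMeasurePreserving (fun t : ∀ i, α i => i.removeNth t) (Measure.pi μ)
      (Measure.pi fun j => μ (i.succAbove j)) :=
  Measure.quasiMeasurePreserving_snd.comp
    (measurePreserving_piFinSuccAbove μ i).quasiMeasurePreserving

end Pi

namespace FinConf

variable {dim : ℕ}

lemma mem_insert_pts {x y : Space dim} {η : FinConf dim} :
    x ∈ (insert y η).pts ↔ x = y ∨ x ∈ η.pts := by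
  simp [insert]

lemma mem_erase_pts {x y : Space dim} {η : FinConf dim} :
    x ∈ (η.erase y).pts ↔ x ≠ y ∧ x ∈ η.pts := by
  simp [erase]

lemma insert_comm (x y : Space dim) (η : FinConf dim) :
    insert x (insert y η) = insert y (insert x η) := by
  ext z
  simp only [mem_insert_pts]
  tauto

lemma insert_eq_self {x : Space dim} {η : FinConf dim} (hx : x ∈ η.pts) : insert x η = η := by
  ext z
  simp only [mem_insert_pts]
  exact ⟨fun h => h.elim (fun h => h ▸ hx) id, Or.inr⟩

lemma erase_insert {x : Space dim} {η : FinConf dim} (hx : x ∉ η.pts) :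
    (insert x η).erase x = η := by
  ext z
  simp only [mem_insert_pts, mem_erase_pts]
  exact ⟨fun h => h.2.resolve_left h.1, fun h => ⟨fun e => hx (e ▸ h), Or.inr h⟩⟩

lemma ofTuple_cons {n : ℕ} (x : Space dim) (t : Fin n → Space dim) :
    ofTuple (Fin.cons x t : Fin (n + 1) → Space dim) = insert x (ofTuple t) := by
  ext z
  simp only [mem_insert_pts, mem_ofTuple, Fin.exists_fin_succ, Fin.cons_zero, Fin.cons_succ,
    eq_comm]

lemma erase_ofTuple {n : ℕ} {t : Fin (n + 1) → Space dim} (ht : Function.Injective t)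
    (i : Fin (n + 1)) : (ofTuple t).erase (t i) = ofTuple (i.removeNth t) := by
  ext z
  simp only [mem_erase_pts, mem_ofTuple, Fin.removeNth]
  constructor
  · rintro ⟨hne, j, rfl⟩
    obtain ⟨k, rfl⟩ := Fin.exists_succAbove_eq (x := j) (y := i) fun h => hne (by rw [h])
    exact ⟨k, rfl⟩
  · rintro ⟨k, rfl⟩
    exact ⟨fun h => Fin.succAbove_ne i k (ht h), _, rfl⟩

lemma card_ofTuple {n : ℕ} {t : Fin n → Space dim} (ht : Function.Injective t) :
    (ofTuple t).card = n := by
  simp [card, ofTuple, Finset.card_image_of_injective _ ht]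

@[elab_as_elim]
lemma induction_insert {p : FinConf dim → Prop} (empty : p empty)
    (insert : ∀ x η, p η → p (insert x η)) (η : FinConf dim) : p η := by
  classical
  obtain ⟨s⟩ := η
  induction s using Finset.induction_on with
  | empty => exact empty
  | insert x s _ ih =>
    convert insert x _ ih
    simp [FinConf.insert]

lemma ae_lebesguePoisson_iff {p : FinConf dim → Prop} (hp : MeasurableSet {η | p η}) :
    (∀ᵐ η ∂lebesguePoisson dim, p η) ↔
      ∀ n, ∀ᵐ t : Fin n → Space dim, Function.Injective t → p (ofTuple t) := by
  rw [lebesguePoisson, Measure.ae_sum_iff' hp]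
  refine forall_congr' fun n => ?_
  rw [Measure.ae_ennreal_smul_measure_iff (ENNReal.inv_ne_zero.2 (ENNReal.natCast_ne_top _)),
    ae_map_iff measurable_ofTuple.aemeasurable hp,
    ae_restrict_iff' isOpen_injective.measurableSet]
  rfl

lemma ae_ofTuple_succ_iff {p : FinConf dim → Prop} (hp : MeasurableSet {η | p η}) {n : ℕ} :
    (∀ᵐ t : Fin (n + 1) → Space dim, Function.Injective t → p (ofTuple t)) ↔
      ∀ᵐ t : Fin n → Space dim, Function.Injective t →
        ∀ᵐ x, x ∉ (ofTuple t).pts → p (insert x (ofTuple t)) := by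
  have hmeas : MeasurableSet
      {t : Fin (n + 1) → Space dim | Function.Injective t → p (ofTuple t)} :=
    isOpen_injective.measurableSet.himp (measurable_ofTuple hp)
  rw [volume_pi, ae_pi_iff_ae_ae_cons hmeas]
  refine Filter.eventually_congr (.of_forall fun t => ?_)
  simp only [Fin.cons_injective_iff, ofTuple_cons, mem_ofTuple, Set.mem_range]
  rw [← Filter.eventually_imp_distrib_left]
  exact Filter.eventually_congr (.of_forall fun x => by tauto)

lemma ae_ae_insert {p : FinConf dim → Prop} (hp : MeasurableSet {η | p η})
    (h : ∀ᵐ η ∂lebesguePoisson dim, p η) :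
    ∀ᵐ η ∂lebesguePoisson dim, ∀ᵐ x, p (insert x η) := by
  have hmeas : MeasurableSet {η : FinConf dim | ∀ᵐ x, p (insert x η)} :=
    measurable_measure_prodMk_right (measurable_insert hp.compl) (measurableSet_singleton 0)
  rw [ae_lebesguePoisson_iff hp] at h
  refine (ae_lebesguePoisson_iff hmeas).2 fun n => ?_
  filter_upwards [h n, (ae_ofTuple_succ_iff hp).1 (h (n + 1))] with t ht htx hinj
  filter_upwards [htx hinj] with x hx
  by_cases hxt : x ∈ (ofTuple t).pts
  · rw [insert_eq_self hxt]
    exact ht hinj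
  · exact hx hxt

lemma measurableSet_forall_erase {p : FinConf dim → Prop} (hp : MeasurableSet {η | p η}) :
    MeasurableSet {η : FinConf dim | ∀ x ∈ η.pts, p (η.erase x)} := by
  have hsum := measurable_sum_erase (dim := dim) (measurable_const (a := 1)) hp.compl
  convert hsum (measurableSet_singleton 0) using 1
  ext η
  simp [Finset.sum_eq_zero_iff]

lemma ae_forall_erase {p : FinConf dim → Prop} (hp : MeasurableSet {η | p η})
    (h : ∀ᵐ η ∂lebesguePoisson dim, p η) :
    ∀ᵐ η ∂lebesguePoisson dim, ∀ x ∈ η.pts, p (η.erase x) := by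
  rw [ae_lebesguePoisson_iff hp] at h
  refine (ae_lebesguePoisson_iff (measurableSet_forall_erase hp)).2 fun n => ?_
  cases n with
  | zero => exact .of_forall fun t _ x hx => (mem_ofTuple.1 hx).choose.elim0
  | succ n =>
    have hremove : ∀ᵐ t : Fin (n + 1) → Space dim, ∀ i : Fin (n + 1),
        Function.Injective (i.removeNth t) → p (ofTuple (i.removeNth t)) := ae_all_iff.2 fun i =>
      (quasiMeasurePreserving_removeNth (fun _ => (volume : Measure (Space dim))) i).ae (h n)
    filter_upwards [hremove] with t ht hinj x hx
    obtain ⟨i, rfl⟩ := mem_ofTuple.1 hx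
    rw [erase_ofTuple hinj]
    exact ht i (hinj.comp Fin.succAbove_right_injective)

lemma ae_lebesguePoisson_of_insert {p : FinConf dim → Prop} (hp : MeasurableSet {η | p η})
    (h_empty : p empty) (h_insert : ∀ η, p η → ∀ᵐ x, p (insert x η)) :
    ∀ᵐ η ∂lebesguePoisson dim, p η := by
  refine (ae_lebesguePoisson_iff hp).2 fun n => ?_
  induction n with
  | zero => exact .of_forall fun t _ => ofTuple_eq_empty_iff (t := t).2 rfl ▸ h_empty
  | succ n ih =>
    refine (ae_ofTuple_succ_iff hp).2 ?_
    filter_upwards [ih] with t ht hinj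
    filter_upwards [h_insert _ (ht hinj)] with x hx _ using hx

lemma dirac_empty_absolutelyContinuous (dim : ℕ) :
    Measure.dirac empty ≪ lebesguePoisson dim := by
  refine Measure.AbsolutelyContinuous.mk fun A hA h0 => ?_
  have hA0 := (ae_lebesguePoisson_iff hA.compl).1 (measure_eq_zero_iff_ae_notMem.1 h0) 0
  obtain ⟨t, ht⟩ := hA0.exists
  rw [Measure.dirac_apply' _ hA, ← ofTuple_eq_empty_iff (t := t).2 rfl]
  exact Set.indicator_of_notMem (ht (Function.injective_of_subsingleton t)) 1

lemma lebesguePoisson_apply {A : Set (FinConf dim)} (hA : MeasurableSet A) :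
    lebesguePoisson dim A = ∑' n : ℕ, ((n ! : ℕ) : ℝ≥0∞)⁻¹ *
      volume {t : Fin n → Space dim | Function.Injective t ∧ ofTuple t ∈ A} := by
  rw [lebesguePoisson, Measure.sum_apply _ hA]
  refine tsum_congr fun n => ?_
  rw [Measure.smul_apply, smul_eq_mul, Measure.map_apply measurable_ofTuple hA,
    Measure.restrict_apply (measurable_ofTuple hA), Set.inter_comm]
  rfl

lemma lebesguePoisson_cball_lt_top (η : FinConf dim) {a : ℝ} (ha : 0 < a) :
    lebesguePoisson dim (cball η a) < ∞ := by
  have hcard : ∀ n ≠ η.card,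
      {t : Fin n → Space dim | Function.Injective t ∧ ofTuple t ∈ cball η a} = ∅ := fun n hn =>
    Set.eq_empty_of_forall_notMem fun t ht => hn ((card_ofTuple ht.1).symm.trans ht.2.1)
  have hcompact : IsCompact (Set.univ.pi fun _ : Fin η.card =>
      ⋃ y ∈ η.pts, Metric.closedBall y a) :=
    isCompact_univ_pi fun _ => η.pts.isCompact_biUnion fun y _ => isCompact_closedBall y a
  rw [lebesguePoisson_apply (measurableSet_cball η ha), tsum_eq_single η.card fun n hn => by
    rw [hcard n hn, measure_empty, mul_zero]]
  refine ENNReal.mul_lt_top ?_ ((measure_mono ?_).trans_lt hcompact.measure_lt_top)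
  · exact ENNReal.inv_lt_top.2 (Nat.cast_pos.2 (Nat.factorial_pos _))
  · rintro t ⟨-, ht⟩ i -
    obtain ⟨f, -, -, hf⟩ := (ofTuple_mem_cball_iff ha.le).1 ht
    exact Set.mem_biUnion (f i).2 (hf i)

instance sigmaFinite_lebesguePoisson : SigmaFinite (lebesguePoisson dim) := by
  have : Nonempty (FinConf dim) := ⟨empty⟩
  -- An `n`-point configuration if there is one; for `dim = 0` and `n ≥ 2` a junk value.
  let center : ℕ → FinConf dim := Function.invFun card
  refine Measure.sigmaFinite_of_countable
    (Set.countable_range fun q : ℕ × ℕ => cball (center q.1) (q.2 + 1)) ?_ ?_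
  · rintro _ ⟨q, rfl⟩
    exact lebesguePoisson_cball_lt_top _ (by positivity)
  · refine Set.sUnion_eq_univ_iff.2 fun ζ => ?_
    obtain ⟨k, hk⟩ := exists_nat_ge (rho (center ζ.card) ζ)
    have hcard : (center ζ.card).card = ζ.card := Function.invFun_eq ⟨ζ, rfl⟩
    exact ⟨_, ⟨(ζ.card, k), rfl⟩, hcard.symm, hk.trans (le_add_of_nonneg_right zero_le_one)⟩

end FinConf

namespace FinConf

variable {dim : ℕ} {C : Set (FinConf dim)} {b : Space dim → FinConf dim → ℝ≥0}

lemma mem_of_insert_mem (herase : ∀ η ∈ C, ∀ x ∈ η.pts, η.erase x ∈ C) {x : Space dim}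
    {η : FinConf dim} (h : insert x η ∈ C) : η ∈ C := by
  by_cases hx : x ∈ η.pts
  · rwa [insert_eq_self hx] at h
  · rw [← erase_insert hx]
    exact herase _ h x (mem_insert_pts.2 (.inl rfl))

lemma empty_mem_of_nonempty (herase : ∀ η ∈ C, ∀ x ∈ η.pts, η.erase x ∈ C) (hC : C.Nonempty) :
    empty ∈ C := by
  obtain ⟨η, hη⟩ := hC
  induction η using induction_insert with
  | empty => exact hη
  | insert x η ih => exact ih (mem_of_insert_mem herase hη)

lemma ae_insert_mem_of_insert_mem (herase : ∀ η ∈ C, ∀ x ∈ η.pts, η.erase x ∈ C)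
    (hinsert : ∀ η ∈ C, ∀ᵐ x, 0 < b x η → insert x η ∈ C) {r : ℝ} (hr : 0 < r)
    (hbr : ∀ η, ∀ y ∈ η.pts, ∀ x ∈ Metric.ball y r, 0 < b x η) {y : Space dim} {η : FinConf dim}
    (hy : insert y η ∈ C) : ∀ᵐ x, insert x η ∈ C := by
  refine ae_mem_of_forall_mem_ae_ball (H := {x | insert x η ∈ C}) hr ⟨y, hy⟩ fun z hz => ?_
  filter_upwards [hinsert _ hz] with x hx hxz
  -- A birth at `x` next to `z`, then the death of `z`.
  have hpair : insert x (insert z η) ∈ C := hx (hbr _ z (mem_insert_pts.2 (.inl rfl)) x hxz)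
  rw [insert_comm] at hpair
  exact mem_of_insert_mem herase hpair

lemma ae_mem_of_erase_mem_of_insert_mem (hCm : MeasurableSet C)
    (herase : ∀ η ∈ C, ∀ x ∈ η.pts, η.erase x ∈ C)
    (hinsert : ∀ η ∈ C, ∀ᵐ x, 0 < b x η → insert x η ∈ C)
    (hseed : empty ∈ C → ∃ x, insert x empty ∈ C) {r : ℝ} (hr : 0 < r)
    (hbr : ∀ η, ∀ y ∈ η.pts, ∀ x ∈ Metric.ball y r, 0 < b x η) (hC : C.Nonempty) :
    ∀ᵐ η ∂lebesguePoisson dim, η ∈ C := by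
  refine ae_lebesguePoisson_of_insert hCm (empty_mem_of_nonempty herase hC) fun η hη => ?_
  obtain ⟨y, hy⟩ : ∃ y, insert y η ∈ C := by
    rcases η.pts.eq_empty_or_nonempty with hη0 | ⟨y, hy⟩
    · obtain rfl : η = empty := FinConf.ext hη0
      exact hseed hη
    · exact ⟨y, (insert_eq_self hy).symm ▸ hη⟩
  exact ae_insert_mem_of_insert_mem herase hinsert hr hbr hy

end FinConf

section JumpChain

variable {dim : ℕ} {b d : Space dim → FinConf dim → ℝ≥0} {Q : Kernel (FinConf dim) (FinConf dim)}
  {p : FinConf dim → Prop} {C : Set (FinConf dim)}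

lemma totalRate_ne_top (b d : Space dim → FinConf dim → ℝ≥0) (η : FinConf dim)
    [NeZero (jumpMeasure b d η)] : totalRate b d η ≠ ∞ := fun h =>
  NeZero.ne (jumpMeasure b d η) (by rw [jumpMeasure, h, ENNReal.inv_top, zero_smul])

lemma ae_jumpMeasure_iff {η : FinConf dim} [NeZero (jumpMeasure b d η)]
    (hb : Measurable fun x => b x η) (hp : MeasurableSet {ζ | p ζ}) :
    (∀ᵐ ζ ∂jumpMeasure b d η, p ζ) ↔
      (∀ᵐ x, 0 < b x η → p (FinConf.insert x η)) ∧ ∀ x ∈ η.pts, 0 < d x η → p (η.erase x) := by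
  have hins : Measurable fun x => FinConf.insert x η :=
    FinConf.measurable_insert.comp measurable_prodMk_right
  have hdeath : ∀ x, (∀ᵐ ζ ∂((d x η : ℝ≥0∞) • Measure.dirac (η.erase x)), p ζ) ↔
      (0 < d x η → p (η.erase x)) := fun x => by
    rcases eq_or_ne (d x η) 0 with hx | hx
    · simp [hx]
    · rw [Measure.ae_ennreal_smul_measure_iff (ENNReal.coe_ne_zero.2 hx), ae_dirac_iff hp,
        imp_iff_right (pos_iff_ne_zero.2 hx)]
  rw [jumpMeasure,
    Measure.ae_ennreal_smul_measure_iff (ENNReal.inv_ne_zero.2 (totalRate_ne_top b d η)),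
    ae_add_measure_iff, ae_map_iff hins.aemeasurable hp,
    ae_withDensity_iff hb.coe_nnreal_ennreal, ae_finsetSum_measure_iff]
  simp only [hdeath, ne_eq, ENNReal.coe_eq_zero, pos_iff_ne_zero]

lemma ae_iff_of_eq_jumpMeasure [IsMarkovKernel Q] (hQ : ∀ η, Q η = jumpMeasure b d η)
    (hb : ∀ η, Measurable fun x => b x η) (hp : MeasurableSet {ζ | p ζ}) (η : FinConf dim) :
    (∀ᵐ ζ ∂Q η, p ζ) ↔
      (∀ᵐ x, 0 < b x η → p (FinConf.insert x η)) ∧ ∀ x ∈ η.pts, 0 < d x η → p (η.erase x) := by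
  have : NeZero (jumpMeasure b d η) := hQ η ▸ inferInstance
  rw [hQ η, ae_jumpMeasure_iff (hb η) hp]

lemma comp_lebesguePoisson_absolutelyContinuous [IsMarkovKernel Q]
    (hQ : ∀ η, Q η = jumpMeasure b d η) (hb : ∀ η, Measurable fun x => b x η) :
    Q ∘ₘ FinConf.lebesguePoisson dim ≪ FinConf.lebesguePoisson dim := by
  refine Measure.AbsolutelyContinuous.mk fun A hA h0 => ?_
  rw [measure_eq_zero_iff_ae_notMem] at h0 ⊢
  refine (Measure.ae_comp_iff hA.compl).2 ?_
  filter_upwards [FinConf.ae_ae_insert hA.compl h0, FinConf.ae_forall_erase hA.compl h0]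
    with η hbirth hdeath
  exact (ae_iff_of_eq_jumpMeasure hQ hb hA.compl η).2
    ⟨hbirth.mono fun x hx _ => hx, fun x hx _ => hdeath x hx⟩

lemma IsAbsorbing.ae_lebesguePoisson_mem [IsMarkovKernel Q] (hC : IsAbsorbing Q C)
    (hQ : ∀ η, Q η = jumpMeasure b d η) (hb : ∀ η, Measurable fun x => b x η)
    (hd : ∀ η, ∀ x ∈ η.pts, 0 < d x η) {r : ℝ} (hr : 0 < r)
    (hbr : ∀ η, ∀ y ∈ η.pts, ∀ x ∈ Metric.ball y r, 0 < b x η) (hne : C.Nonempty) :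
    ∀ᵐ η ∂FinConf.lebesguePoisson dim, η ∈ C := by
  have hmem := fun η hη => (ae_iff_of_eq_jumpMeasure hQ hb hC.measurableSet η).1 (hC.ae_mem η hη)
  have hseed : FinConf.empty ∈ C → ∃ x, FinConf.insert x FinConf.empty ∈ C := fun h0 => by
    -- Otherwise `Q ∅`, which allows no death, would give no mass to `C`.
    by_contra! hno
    have hbirth : ∀ᵐ ζ ∂Q FinConf.empty, ζ ∉ C :=
      (ae_iff_of_eq_jumpMeasure hQ hb hC.measurableSet.compl _).2
        ⟨.of_forall fun x _ => hno x, by simp [FinConf.empty]⟩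
    obtain ⟨ζ, hζ, hζ'⟩ := ((hC.ae_mem _ h0).and hbirth).exists
    exact hζ' hζ
  exact FinConf.ae_mem_of_erase_mem_of_insert_mem hC.measurableSet
    (fun η hη x hx => (hmem η hη).2 x hx (hd η x hx)) (fun η hη => (hmem η hη).1) hseed hr hbr hne

end JumpChain

namespace AdmissibleRates

variable {dim : ℕ} {b d : Space dim → FinConf dim → ℝ≥0}

lemma measurable_birth_left (h : AdmissibleRates b d) (η : FinConf dim) :
    Measurable fun x => b x η :=
  (FinConf.measurable_of_continuous h.continuous_birth).comp measurable_prodMk_right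

lemma death_rate_pos (h : AdmissibleRates b d) (η : FinConf dim) :
    ∀ x ∈ η.pts, 0 < d x η := by
  obtain ⟨δ, hδ, hd⟩ := h.death_pos
  exact fun x hx => hδ.trans_le (hd η x hx)

lemma exists_forall_mem_ball_birth_pos (h : AdmissibleRates b d) :
    ∃ r : ℝ, 0 < r ∧ ∀ η, ∀ y ∈ η.pts, ∀ x ∈ Metric.ball y r, 0 < b x η := by
  obtain ⟨r, c₃, hr, -, hb, -⟩ := h.birth_pos
  exact ⟨r, hr, fun η y hy x hx => pos_of_gt (hb x η ⟨y, hy, (Metric.mem_ball.1 hx).le⟩)⟩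

end AdmissibleRates

theorem theorem4p1_general {dim : ℕ} {b d : Space dim → FinConf dim → ℝ≥0}
    {Q : Kernel (FinConf dim) (FinConf dim)} [IsMarkovKernel Q]
    (hQ : ∀ η, Q η = jumpMeasure b d η) (hb : ∀ η, Measurable fun x => b x η)
    (hd : ∀ η, ∀ x ∈ η.pts, 0 < d x η) {r : ℝ} (hr : 0 < r)
    (hbr : ∀ η, ∀ y ∈ η.pts, ∀ x ∈ Metric.ball y r, 0 < b x η) :
    IsMaximalIrreducibilityMeasure Q (FinConf.lebesguePoisson dim) := by
  have : Kernel.IsIrreducible (FinConf.lebesguePoisson dim) Q :=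
    isIrreducible_of_isAbsorbing fun _ hC => hC.ae_lebesguePoisson_mem hQ hb hd hr hbr
  exact isMaximalIrreducibilityMeasure_of_isIrreducible
    (comp_lebesguePoisson_absolutelyContinuous hQ hb) (FinConf.dirac_empty_absolutelyContinuous dim)

theorem theorem4p1 (dim : ℕ) (hdim : 1 ≤ dim) (b d : Space dim → FinConf dim → ℝ≥0)
    (h : AdmissibleRates b d) :
    IsMaximalIrreducibilityMeasure h.jumpKernel (FinConf.lebesguePoisson dim) := by
  obtain ⟨r, hr, hbr⟩ := h.exists_forall_mem_ball_birth_pos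
  exact theorem4p1_general (fun _ => rfl) h.measurable_birth_left h.death_rate_pos hr hbr
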